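/- **Definitions.** A signature $\Sigma$ is a set of operators, each with a rank in $\mathbb N$. $\mathsf T(\Sigma)$ denotes the closed terms (processes), $\Delta(\mathsf T(\Sigma))$ the discrete probability distributions on them, and $\delta(t)$ the Dirac distribution at $t$. Distribution terms are built from distribution variables and $\delta(t)$ ($t$ a term) by convex combinations $\sum_{i\in I}p_i\theta_i$ ($p_i\in(0,1]$, $\sum_i p_i=1$; $\theta_1\oplus_p\theta_2$ is $p\,\theta_1+(1-p)\theta_2$) and by operators $f(\theta_1,\dots,\theta_n)$; closed distribution terms denote distributions, where $f(\pi_1,\dots,\pi_n)$ is the image of the product distribution under $(t_1,\dots,t_n)\mapsto f(t_1,\dots,t_n)$. A PTSS (in PGSOS format) $P=(\Sigma,A,R)$ consists of a signature, a set $A$ of actions and a set $R$ of rules $$\frac{\{x_i\xrightarrow{a_{i,k}}\mu_{i,k}\}_{1\le i\le n,\,k\in K_i}\quad\{x_i\not\xrightarrow{b_{i,l}}\}_{1\le i\le n,\,l\in L_i}}{f(x_1,\dots,x_n)\xrightarrow{a}\theta}$$ with $f\in\Sigma$ of rank $n$, $K_i,L_i$ finite, the state variables $x_i$ pairwise different,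 the distribution variables $\mu_{i,k}$ pairwise different, and $\theta$ a distribution term with variables among the $x_i,\mu_{i,k}$, such that for all $f$ and $a$ only finitely many rules have operator $f$ and conclusion label $a$; rules are taken up to renaming of variables. Its induced model is the unique transition relation ${\to}\subseteq\mathsf T(\Sigma)\times A\times\Delta(\mathsf T(\Sigma))$ that contains exactly the conclusions of those closed instances of rules of $R$ whose premises hold in $\to$. A PTSS $P_2=(\Sigma_2,A,R_2)$ is a disjoint extension of $P_1=(\Sigma_1,A,R_1)$, written $P_1\sqsubseteq P_2$, if $\Sigma_1\subseteq\Sigma_2$, $R_1\subseteq R_2$ and every rule in $R_2\setminus R_1$ is for an operator outside $\Sigma_1$. Fix $\surd\in A$. The PTSS $P_{\mathrm{PA}}$ has the constants $0$, $\varepsilon$, the $n$-ary prefixes $a.\bigoplus_{i=1}^n[p_i]\_$ ($a\in A$, $n\ge1$, $p_i\in(0,1]$, $\sum_i p_i=1$) and the binary operators $;$, $+$, $+_p$, $\mid$, $|||$, $|||_p$ ($p\in(0,1)$), $\parallel_B$ ($B\subseteq A$), and the following rules, for all $a\in A$ subject to the side conditions: * $\varepsilon\xrightarrow{\surd}\delta(0)$;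 $\quad a.\bigoplus_i[p_i]x_i\xrightarrow{a}\sum_i p_i\delta(x_i)$; * $x;y\xrightarrow{a}\mu;\delta(y)$ if $x\xrightarrow{a}\mu$, $a\ne\surd$; $\quad x;y\xrightarrow{a}\nu$ if $x\xrightarrow{\surd}\mu$, $y\xrightarrow{a}\nu$; * $x+y\xrightarrow{a}\mu$ if $x\xrightarrow{a}\mu$; $\quad x+y\xrightarrow{a}\nu$ if $y\xrightarrow{a}\nu$; * $x+_py\xrightarrow{a}\mu$ if $x\xrightarrow{a}\mu$, $y\not\xrightarrow{a}$; $\quad x+_py\xrightarrow{a}\nu$ if $x\not\xrightarrow{a}$, $y\xrightarrow{a}\nu$; $\quad x+_py\xrightarrow{a}\mu\oplus_p\nu$ if $x\xrightarrow{a}\mu$, $y\xrightarrow{a}\nu$; * $x\mid y\xrightarrow{a}\mu\mid\nu$ if $x\xrightarrow{a}\mu$, $y\xrightarrow{a}\nu$, $a\ne\surd$; * $x\,|||\,y\xrightarrow{a}\mu\,|||\,\delta(y)$ if $x\xrightarrow{a}\mu$, $a\ne\surd$; $\quad x\,|||\,y\xrightarrow{a}\delta(x)\,|||\,\nu$ if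 $y\xrightarrow{a}\nu$, $a\neq\surd$; * $x\,|||_p\,y\xrightarrow{a}\mu\,|||_p\,\delta(y)$ if $x\xrightarrow{a}\mu$, $y\not\xrightarrow{a}$, $a\ne\surd$; $\quad x\,|||_p\,y\xrightarrow{a}\delta(x)\,|||_p\,\nu$ if $x\not\xrightarrow{a}$, $y\xrightarrow{a}\nu$, $a\ne\surd$; $\quad x\,|||_p\,y\xrightarrow{a}(\mu\,|||_p\,\delta(y))\oplus_p(\delta(x)\,|||_p\,\nu)$ if $x\xrightarrow{a}\mu$, $y\xrightarrow{a}\nu$, $a\ne\surd$; * $x\parallel_By\xrightarrow{a}\mu\parallel_B\nu$ if $x\xrightarrow{a}\mu$, $y\xrightarrow{a}\nu$, $a\in B\setminus\{\surd\}$; $\quad x\parallel_By\xrightarrow{a}\mu\parallel_B\delta(y)$ if $x\xrightarrow{a}\mu$, $a\notin B\cup\{\surd\}$; $\quad x\parallel_By\xrightarrow{a}\delta(x)\parallel_B\nu$ if $y\xrightarrow{a}\nu$, $a\notin B\cup\{\surd\}$; * for each operator $\star$ among $\mid,\ |||,\ |||_p,\ \parallel_B$: $\ x\star y\xrightarrow{\surd}\delta(0)$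 if $x\xrightarrow{\surd}\mu$, $y\xrightarrow{\surd}\nu$. For $d\colon\mathsf T(\Sigma)^2\to[0,1]$ let $\mathbf K(d)(\pi,\pi')=\min_\omega\sum_{t,t'}d(t,t')\,\omega(t,t')$, where $\omega$ ranges over the distributions on $\mathsf T(\Sigma)^2$ with marginals $\pi$ and $\pi'$. For $\lambda\in(0,1]$, a $\lambda$-bisimulation metric is a pseudometric $d\colon\mathsf T(\Sigma)^2\to[0,1]$ such that whenever $d(t,t')<1$ and $t\xrightarrow{a}\pi$, there is $t'\xrightarrow{a}\pi'$ with $\lambda\cdot\mathbf K(d)(\pi,\pi')\le d(t,t')$. **Proposition.** Let $P=(\Sigma,A,R)$ be any PTSS with $P_{\mathrm{PA}}\sqsubseteq P$ and let $\lambda\in(0,1]$. Then there is a smallest (for the pointwise order) $\lambda$-bisimulation metric $\mathbf d$ on $\mathsf T(\Sigma)$, the $\lambda$-bisimilarity metric of the induced model of $P$, and for all terms $s_i,t_i\in\mathsf T(\Sigma)$: (a) $\mathbf d\bigl(a.\bigoplus_{i=1}^n[p_i]s_i,\ a.\bigoplus_{i=1}^n[p_i]t_i\bigr)\le\lambda\cdot\sum_{i=1}^n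 p_i\,\mathbf d(s_i,t_i)$ for all $a\in A$, $n\ge1$ and $p_1,\dots,p_n\in(0,1]$ with $\sum_i p_i=1$; (b) $\mathbf d(s_1+s_2,\ t_1+t_2)\le\max(\mathbf d(s_1,t_1),\mathbf d(s_2,t_2))$; (c) $\mathbf d(s_1+_ps_2,\ t_1+_pt_2)\le\max(\mathbf d(s_1,t_1),\mathbf d(s_2,t_2))$ for all $p\in(0,1)$. -/

import Mathlib

open FirstOrder
open scoped ENNReal

noncomputable section

namespace PPA

universe u v w u₁ v₁

/-! ### Terms, distribution terms and their meaning

A signature is a first-order language: `L.Functions n` is the set of its operators of rank `n`,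
and relation symbols play no role. State terms over a set `V` of variables are `L.Term V`. -/

/-- Closed state terms (processes). -/
abbrev Proc (L : FirstOrder.Language.{u, v}) : Type u := L.Term Empty

/-- Distribution terms over state variables `V` and distribution variables `W`. In a convex
combination all weights are positive and sum to one, so the index set `I` is countable
(possibly infinite). -/
inductive DTerm (L : FirstOrder.Language.{u, v}) (V W : Type) : Type (max 1 u)
  | var (m : W) : DTerm L V W
  | dirac (t : L.Term V) : DTerm L V W
  | conv {I : Type} (p : PMF I) (hp : ∀ i, 0 < p i) (θ : I → DTerm L V W) : DTerm L V W
  | op {n : ℕ} (f : L.Functions n) (θ : Fin n → DTerm L V W) : DTerm L V W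

/-- Closed distribution terms. -/
abbrev CDTerm (L : FirstOrder.Language.{u, v}) : Type (max 1 u) := DTerm L Empty Empty

/-- Application of a substitution to a distribution term. -/
def DTerm.subst {L : FirstOrder.Language.{u, v}} {V W V' W' : Type}
    (σs : V → L.Term V') (σd : W → DTerm L V' W') : DTerm L V W → DTerm L V' W'
  | .var m => σd m
  | .dirac t => .dirac (t.subst σs)
  | .conv p hp θ => .conv p hp fun i => (θ i).subst σs σd
  | .op f θ => .op f fun i => (θ i).subst σs σd

/-- Translation of a distribution term along a map of signatures. -/
def DTerm.map {L : FirstOrder.Language.{u, v}} {L' : FirstOrder.Language.{u₁, v₁}} {V W : Type} (φ : L →ᴸ L') :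
    DTerm L V W → DTerm L' V W
  | .var m => .var m
  | .dirac t => .dirac (φ.onTerm t)
  | .conv p hp θ => .conv p hp fun i => (θ i).map φ
  | .op f θ => .op (φ.onFunction f) fun i => (θ i).map φ

/-- The product distribution on tuples; see `prodPMF_apply`. -/
def prodPMF {T : Type u} : {n : ℕ} → (Fin n → PMF T) → PMF (Fin n → T)
  | 0, _ => PMF.pure Fin.elim0
  | _ + 1, π => (π 0).bind fun t => (prodPMF fun i => π i.succ).map fun ts => Fin.cons t ts

theorem prodPMF_apply {T : Type u} {n : ℕ} (π : Fin n → PMF T) (ts : Fin n → T) :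
    prodPMF π ts = ∏ i, π i (ts i) := by
  induction n with
  | zero =>
    have h : ts = Fin.elim0 := Subsingleton.elim _ _
    subst h
    simp [prodPMF]
  | succ n ih =>
    classical
    rw [prodPMF, PMF.bind_apply, Fin.prod_univ_succ, tsum_eq_single (ts 0)]
    · congr 1
      rw [PMF.map_apply, tsum_eq_single (fun i => ts i.succ)]
      · have h : ts = Fin.cons (ts 0) fun i => ts i.succ := (Fin.cons_self_tail ts).symm
        rw [if_pos h, ih]
      · intro us hus
        rw [if_neg]
        intro h
        refine hus (funext fun i => ?_)
        rw [h]
        rfl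
    · intro t ht
      rw [PMF.map_apply, ENNReal.tsum_eq_zero.2, mul_zero]
      intro us
      rw [if_neg]
      rintro rfl
      exact ht rfl

/-- The distribution over processes denoted by a closed distribution term. -/
def CDTerm.denote {L : FirstOrder.Language.{u, v}} : CDTerm L → PMF (Proc L)
  | .var m => m.elim
  | .dirac t => PMF.pure t
  | .conv p _ θ => p.bind fun i => CDTerm.denote (θ i)
  | .op f θ => (prodPMF fun i => CDTerm.denote (θ i)).map fun ts => FirstOrder.Language.Term.func f ts

/-! ### PGSOS specifications and their models -/

/-- A PGSOS rule with source `f(x₁, …, xₙ)` and a given conclusion label, for an operator `f` of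
rank `n`. Rules are taken up to renaming of variables: the source variables are the elements of
`Fin n`, and the right-hand side of the `k`-th positive premise of `xᵢ` is the distribution
variable `⟨i, k⟩`. Hence the source variables are pairwise different, so are the distribution
variables, and no other variable occurs in the target. -/
structure Rule (L : FirstOrder.Language.{u, v}) (A : Type w) (n : ℕ) where
  /-- number of positive premises of each source variable -/
  numPos : Fin n → ℕ
  /-- labels of the positive premises -/
  posAct : (i : Fin n) → Fin (numPos i) → A
  /-- labels of the negative premises -/
  negAct : Fin n → Finset A
  /-- target of the conclusion -/
  target : DTerm L (Fin n) (Σ i, Fin (numPos i))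

/-- Translation of a rule along a map of signatures. -/
def Rule.map {L : FirstOrder.Language.{u, v}} {L' : FirstOrder.Language.{u₁, v₁}} {A : Type w} {n : ℕ} (φ : L →ᴸ L')
    (r : Rule L A n) : Rule L' A n :=
  ⟨r.numPos, r.posAct, r.negAct, r.target.map φ⟩

/-- A probabilistic transition system specification in PGSOS format: `rules f a` is the (finite)
set of the rules for the operator `f` whose conclusion is labelled `a`. -/
structure PTSS (L : FirstOrder.Language.{u, v}) (A : Type w) where
  rules : {n : ℕ} → L.Functions n → A → Set (Rule L A n)
  finite_rules : ∀ {n : ℕ} (f : L.Functions n) (a : A), (rules f a).Finite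

/-- Transition relations of PTSs: `tr t a π` means that `t` has an `a`-labelled transition
to `π`. -/
abbrev TransRel (L : FirstOrder.Language.{u, v}) (A : Type w) : Type (max u w) :=
  Proc L → A → PMF (Proc L) → Prop

/-- `f(t₁, …, tₙ)` can do an `a`-labelled transition to `π` by the instance of the rule `r` under
the closed substitution `xᵢ ↦ tᵢ`, `μ ↦ σ μ`, all premises being satisfied in `tr`. -/
def Rule.Derives {L : FirstOrder.Language.{u, v}} {A : Type w} {n : ℕ} (r : Rule L A n)
    (tr : TransRel L A) (ts : Fin n → Proc L) (σ : (Σ i, Fin (r.numPos i)) → CDTerm L)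
    (π : PMF (Proc L)) : Prop :=
  (∀ i k, tr (ts i) (r.posAct i k) (CDTerm.denote (σ ⟨i, k⟩))) ∧
  (∀ i, ∀ b ∈ r.negAct i, ∀ ρ, ¬ tr (ts i) b ρ) ∧
  π = CDTerm.denote (r.target.subst ts σ)

/-- The transition `t —a→ π` is justified in `tr` by some rule of `P`. -/
def PTSS.Supports {L : FirstOrder.Language.{u, v}} {A : Type w} (P : PTSS L A) (tr : TransRel L A)
    (t : Proc L) (a : A) (π : PMF (Proc L)) : Prop :=
  ∃ (n : ℕ) (f : L.Functions n) (ts : Fin n → Proc L), t = FirstOrder.Language.Term.func f ts ∧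
    ∃ r ∈ P.rules f a, ∃ σ, r.Derives tr ts σ π

/-- Supported models: they contain all and only the transitions that the rules justify. -/
def PTSS.IsSupportedModel {L : FirstOrder.Language.{u, v}} {A : Type w} (P : PTSS L A)
    (tr : TransRel L A) : Prop :=
  ∀ t a π, tr t a π ↔ P.Supports tr t a π

/-- Auxiliary recursion that constructs the supported model. -/
def PTSS.transAux {L : FirstOrder.Language.{u, v}} {A : Type w} (P : PTSS L A) :
    Proc L → A → PMF (Proc L) → Prop
  | .var e => e.elim
  | .func f ts => fun a π => ∃ r ∈ P.rules f a, ∃ σ : (Σ i, Fin (r.numPos i)) → CDTerm L,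
      (∀ i k, P.transAux (ts i) (r.posAct i k) (CDTerm.denote (σ ⟨i, k⟩))) ∧
      (∀ i, ∀ b ∈ r.negAct i, ∀ ρ, ¬ P.transAux (ts i) b ρ) ∧
      π = CDTerm.denote (r.target.subst ts σ)

theorem PTSS.existsUnique_isSupportedModel {L : FirstOrder.Language.{u, v}} {A : Type w} (P : PTSS L A) :
    ∃! tr : TransRel L A, P.IsSupportedModel tr := by
  have key : ∀ tr : TransRel L A, ∀ {n : ℕ} (f : L.Functions n) (ts : Fin n → Proc L) a π,
      P.Supports tr (.func f ts) a π ↔ ∃ r ∈ P.rules f a, ∃ σ, r.Derives tr ts σ π := by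
    intro tr n f ts a π
    constructor
    · rintro ⟨m, g, us, h, H⟩
      cases h
      exact H
    · intro H
      exact ⟨n, f, ts, rfl, H⟩
  refine ⟨P.transAux, ?_, ?_⟩
  · intro t a π
    cases t with
    | var e => exact e.elim
    | func f ts =>
      rw [key, PTSS.transAux]
      rfl
  · intro tr htr
    funext t
    induction t with
    | var e => exact e.elim
    | func f ts ih =>
      funext a π
      rw [eq_iff_iff, htr, key, PTSS.transAux]
      simp only [Rule.Derives, ih]

/-- The induced model of `P`: its unique supported model. -/
def PTSS.trans {L : FirstOrder.Language.{u, v}} {A : Type w} (P : PTSS L A) : TransRel L A :=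
  P.existsUnique_isSupportedModel.choose

/-- `P₂` is a disjoint extension of `P₁`, where `φ` is the inclusion of the signature of `P₁` in
that of `P₂`: for the operators of `P₁`, the rules of `P₂` are exactly those of `P₁`. -/
structure IsDisjointExtension {L₁ : FirstOrder.Language.{u, v}} {L₂ : FirstOrder.Language.{u₁, v₁}} {A : Type w}
    (φ : L₁ →ᴸ L₂) (P₁ : PTSS L₁ A) (P₂ : PTSS L₂ A) : Prop where
  injective : ∀ n : ℕ, Function.Injective fun f : L₁.Functions n => φ.onFunction f
  rules_eq : ∀ {n : ℕ} (f : L₁.Functions n) (a : A),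
    P₂.rules (φ.onFunction f) a = Rule.map φ '' P₁.rules f a

/-! ### Bisimulation metrics -/

/-- 1-bounded pseudometrics. -/
structure IsPseudometric {T : Type u} (d : T → T → ℝ≥0∞) : Prop where
  le_one : ∀ s t, d s t ≤ 1
  self : ∀ t, d t t = 0
  symm : ∀ s t, d s t = d t s
  triangle : ∀ s t r, d s t ≤ d s r + d r t

/-- `ω` is a matching for `(π, π')`. -/
def IsMatching {T : Type u} (π π' : PMF T) (ω : PMF (T × T)) : Prop :=
  (∀ t, ∑' t', ω (t, t') = π t) ∧ (∀ t', ∑' t, ω (t, t') = π' t')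

/-- The Kantorovich lifting (the infimum is a minimum). -/
def kantorovich {T : Type u} (d : T → T → ℝ≥0∞) (π π' : PMF T) : ℝ≥0∞ :=
  ⨅ (ω : PMF (T × T)) (_ : IsMatching π π' ω), ∑' q : T × T, d q.1 q.2 * ω q

/-- `lam`-bisimulation metrics. -/
structure IsBisimMetric {L : FirstOrder.Language.{u, v}} {A : Type w} (tr : TransRel L A) (lam : ℝ≥0∞)
    (d : Proc L → Proc L → ℝ≥0∞) : Prop where
  pseudometric : IsPseudometric d
  transfer : ∀ t t', d t t' < 1 → ∀ a π, tr t a π →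
    ∃ π', tr t' a π' ∧ lam * kantorovich d π π' ≤ d t t'

/-- The `lam`-bisimilarity metric of the induced model of `P`: the infimum, for the pointwise
order, of all `lam`-bisimulation metrics. (That it is itself a `lam`-bisimulation metric, hence
the smallest one, is a part of the theorem below.) -/
def PTSS.bisimDist {L : FirstOrder.Language.{u, v}} {A : Type w} (P : PTSS L A) (lam : ℝ≥0∞) :
    Proc L → Proc L → ℝ≥0∞ :=
  sInf {d | IsBisimMetric P.trans lam d}

/-! ### The process algebra -/

/-- The operators of the process algebra, by rank. -/
inductive PAOp (A : Type u) : ℕ → Type u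
  /-- `0` -/
  | nil : PAOp A 0
  /-- `ε` -/
  | skip : PAOp A 0
  /-- `a.([p₁]_ ⊕ … ⊕ [pₙ]_)`; a distribution on `Fin n` exists only for `n ≥ 1` -/
  | pre {n : ℕ} (a : A) (p : PMF (Fin n)) (hp : ∀ i, 0 < p i) : PAOp A n
  /-- `_ ; _` -/
  | seq : PAOp A 2
  /-- `_ + _` -/
  | alt : PAOp A 2
  /-- `_ +_p _` -/
  | palt (p : ℝ≥0∞) (h0 : 0 < p) (h1 : p < 1) : PAOp A 2
  /-- `_ | _` -/
  | sync : PAOp A 2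
  /-- `_ ||| _` -/
  | par : PAOp A 2
  /-- `_ |||_p _` -/
  | ppar (p : ℝ≥0∞) (h0 : 0 < p) (h1 : p < 1) : PAOp A 2
  /-- `_ ‖_B _` -/
  | csp (B : Set A) : PAOp A 2

/-- The signature of the process algebra. -/
abbrev paLang (A : Type u) : FirstOrder.Language.{u, 0} := ⟨PAOp A, fun _ => Empty⟩

/-- `θ₁ ⊕_p θ₂` -/
def DTerm.choice {L : FirstOrder.Language.{u, v}} {V W : Type} (p : ℝ≥0∞) (h0 : 0 < p) (h1 : p < 1)
    (θ₁ θ₂ : DTerm L V W) : DTerm L V W :=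
  .conv (PMF.ofFintype ![p, 1 - p] (by simp [h1.le]))
    (by simp [Fin.forall_fin_two, h0, h1]) ![θ₁, θ₂]

/-- `f(θ₁, θ₂)` -/
def paOp₂ {A : Type u} {V W : Type} (f : PAOp A 2) (θ₁ θ₂ : DTerm (paLang A) V W) :
    DTerm (paLang A) V W :=
  .op (L := paLang A) f ![θ₁, θ₂]

/-- `δ(0)` -/
def paDiracNil {A : Type u} {V W : Type} : DTerm (paLang A) V W :=
  .dirac (FirstOrder.Language.Term.func (L := paLang A) PAOp.nil Fin.elim0)

/-- The rule with the premises `x —a→ μ` and `y —b↛` for all `b ∈ N`; the target may use `μ`,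
`δ(x)` and `δ(y)`. -/
def ruleL {A : Type u} (a : A) (N : Finset A)
    (θ : {W : Type} → (μ δx δy : DTerm (paLang A) (Fin 2) W) → DTerm (paLang A) (Fin 2) W) :
    Rule (paLang A) A 2 where
  numPos := ![1, 0]
  posAct := fun _ _ => a
  negAct := ![∅, N]
  target := θ (.var ⟨0, (0 : Fin 1)⟩) (.dirac (.var 0)) (.dirac (.var 1))

/-- The rule with the premises `y —a→ ν` and `x —b↛` for all `b ∈ N`; the target may use `ν`,
`δ(x)` and `δ(y)`. -/
def ruleR {A : Type u} (a : A) (N : Finset A)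
    (θ : {W : Type} → (ν δx δy : DTerm (paLang A) (Fin 2) W) → DTerm (paLang A) (Fin 2) W) :
    Rule (paLang A) A 2 where
  numPos := ![0, 1]
  posAct := fun _ _ => a
  negAct := ![N, ∅]
  target := θ (.var ⟨1, (0 : Fin 1)⟩) (.dirac (.var 0)) (.dirac (.var 1))

/-- The rule with the premises `x —a→ μ` and `y —b→ ν`. -/
def ruleLR {A : Type u} (a b : A)
    (θ : {W : Type} → (μ ν δx δy : DTerm (paLang A) (Fin 2) W) → DTerm (paLang A) (Fin 2) W) :
    Rule (paLang A) A 2 where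
  numPos := fun _ => 1
  posAct := fun i _ => ![a, b] i
  negAct := fun _ => ∅
  target := θ (.var ⟨0, 0⟩) (.var ⟨1, 0⟩) (.dirac (.var 0)) (.dirac (.var 1))

/-- The rules of the process algebra; `tick` is the successful termination action. -/
def paRules {A : Type u} (tick : A) :
    {n : ℕ} → PAOp A n → A → Set (Rule (paLang A) A n)
  | _, .nil, _ => ∅
  | _, .skip, a => {r | a = tick ∧ r =
      { numPos := fun _ => 0, posAct := fun _ _ => a, negAct := fun _ => ∅,
        target := paDiracNil }}
  | _, .pre b p hp, a => {r | a = b ∧ r =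
      { numPos := fun _ => 0, posAct := fun _ _ => a, negAct := fun _ => ∅,
        target := .conv p hp fun i => .dirac (.var i) }}
  | _, .seq, a =>
      {r | a ≠ tick ∧ r = ruleL a ∅ fun μ _ δy => paOp₂ .seq μ δy} ∪
      {ruleLR tick a fun _ ν _ _ => ν}
  | _, .alt, a =>
      {ruleL a ∅ fun μ _ _ => μ} ∪
      {ruleR a ∅ fun ν _ _ => ν}
  | _, .palt p h0 h1, a =>
      {ruleL a {a} fun μ _ _ => μ} ∪
      {ruleR a {a} fun ν _ _ => ν} ∪
      {ruleLR a a fun μ ν _ _ => .choice p h0 h1 μ ν}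
  | _, .sync, a =>
      {r | a ≠ tick ∧ r = ruleLR a a fun μ ν _ _ => paOp₂ .sync μ ν} ∪
      {r | a = tick ∧ r = ruleLR tick tick fun _ _ _ _ => paDiracNil}
  | _, .par, a =>
      {r | a ≠ tick ∧ r = ruleL a ∅ fun μ _ δy => paOp₂ .par μ δy} ∪
      {r | a ≠ tick ∧ r = ruleR a ∅ fun ν δx _ => paOp₂ .par δx ν} ∪
      {r | a = tick ∧ r = ruleLR tick tick fun _ _ _ _ => paDiracNil}
  | _, .ppar p h0 h1, a =>
      {r | a ≠ tick ∧ r = ruleL a {a} fun μ _ δy => paOp₂ (.ppar p h0 h1) μ δy} ∪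
      {r | a ≠ tick ∧ r = ruleR a {a} fun ν δx _ => paOp₂ (.ppar p h0 h1) δx ν} ∪
      {r | a ≠ tick ∧ r = ruleLR a a fun μ ν δx δy =>
        .choice p h0 h1 (paOp₂ (.ppar p h0 h1) μ δy) (paOp₂ (.ppar p h0 h1) δx ν)} ∪
      {r | a = tick ∧ r = ruleLR tick tick fun _ _ _ _ => paDiracNil}
  | _, .csp B, a =>
      {r | (a ∈ B ∧ a ≠ tick) ∧ r = ruleLR a a fun μ ν _ _ => paOp₂ (.csp B) μ ν} ∪
      {r | a = tick ∧ r = ruleLR tick tick fun _ _ _ _ => paDiracNil} ∪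
      {r | (a ∉ B ∧ a ≠ tick) ∧ r = ruleL a ∅ fun μ _ δy => paOp₂ (.csp B) μ δy} ∪
      {r | (a ∉ B ∧ a ≠ tick) ∧ r = ruleR a ∅ fun ν δx _ => paOp₂ (.csp B) δx ν}

theorem finite_setOf_and_eq {α : Type*} (q : Prop) (b : α) : {r | q ∧ r = b}.Finite :=
  (Set.finite_singleton b).subset fun _ h => h.2

/-- The specification of the process algebra. -/
def paPTSS {A : Type u} (tick : A) : PTSS (paLang A) A where
  rules := fun f a => paRules tick (show PAOp A _ from f) a
  finite_rules := by
    intro n f a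
    cases (show PAOp A n from f) <;>
      simp only [paRules, Set.finite_union, finite_setOf_and_eq, Set.finite_singleton,
        Set.finite_empty, and_self]

end PPA

end

/-!
The `lam`-bisimilarity metric is the least fixed point of the functional that sends `d` to the
Hausdorff-style distance between the sets of outgoing transitions, measured by `lam` times the
Kantorovich lifting of `d` and truncated at `1`. This functional preserves pseudometrics (the
triangle inequality comes from gluing matchings along their common marginal), and so do pointwise
suprema; hence its least fixed point is a pseudometric. In an image-finite model the infima in the
functional are attained, so the pseudometrics among its pre-fixed points are exactly the
bisimulation metrics. Induced models are image-finite because each operator and label has finitely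
many rules, each with finitely many premises.

A bound on the distance of two composite processes thus needs only one unfolding of the fixed
point: transitions of the operands are combined by the rules of the operator, and the Kantorovich
lifting is convex under mixtures.
-/

namespace PPA

universe u v w

section Kantorovich

variable {T : Type u} {d d' : T → T → ℝ≥0∞} {π π' ρ : PMF T}

theorem kantorovich_mono (h : d ≤ d') (π π' : PMF T) : kantorovich d π π' ≤ kantorovich d' π π' :=
  iInf₂_mono fun _ _ => ENNReal.tsum_le_tsum fun q => mul_le_mul_left (h q.1 q.2) _

theorem kantorovich_le_of_isMatching (d : T → T → ℝ≥0∞) {ω : PMF (T × T)}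
    (h : IsMatching π π' ω) : kantorovich d π π' ≤ ∑' q : T × T, d q.1 q.2 * ω q :=
  iInf₂_le ω h

theorem kantorovich_le_of_marginals (d : T → T → ℝ≥0∞) (ω : T → T → ℝ≥0∞)
    (hπ : ∀ t, ∑' t', ω t t' = π t) (hπ' : ∀ t', ∑' t, ω t t' = π' t') :
    kantorovich d π π' ≤ ∑' t, ∑' t', d t t' * ω t t' := by
  have hsum : ∑' q : T × T, ω q.1 q.2 = 1 := by
    rw [ENNReal.tsum_prod (f := ω)]
    simp only [hπ, PMF.tsum_coe]
  let ω' : PMF (T × T) := ⟨fun q => ω q.1 q.2, hsum ▸ ENNReal.summable.hasSum⟩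
  exact (kantorovich_le_of_isMatching d (ω := ω') ⟨hπ, hπ'⟩).trans_eq
    (ENNReal.tsum_prod (f := fun t t' => d t t' * ω t t'))

theorem isMatching_iff_map {ω : PMF (T × T)} :
    IsMatching π π' ω ↔ ω.map Prod.fst = π ∧ ω.map Prod.snd = π' := by
  have hfst (t : T) : ω.map Prod.fst t = ∑' t', ω (t, t') := by
    simp only [PMF.map_apply, ENNReal.tsum_prod']
    rw [tsum_eq_single t (by simp +contextual [eq_comm])]
    simp
  have hsnd (t' : T) : ω.map Prod.snd t' = ∑' t, ω (t, t') := by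
    simp only [PMF.map_apply, ENNReal.tsum_prod']
    exact tsum_congr fun t => (tsum_eq_single t' (by simp +contextual [eq_comm])).trans (by simp)
  simp only [IsMatching, PMF.ext_iff, hfst, hsnd]

theorem isMatching_pure (s t : T) : IsMatching (PMF.pure s) (PMF.pure t) (PMF.pure (s, t)) :=
  isMatching_iff_map.2 ⟨PMF.pure_map _ _, PMF.pure_map _ _⟩

theorem IsMatching.bind {I : Type v} (p : PMF I) {f g : I → PMF T} {ω : I → PMF (T × T)}
    (h : ∀ i, IsMatching (f i) (g i) (ω i)) : IsMatching (p.bind f) (p.bind g) (p.bind ω) := by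
  simp only [isMatching_iff_map, PMF.map_bind] at h ⊢
  exact ⟨by simp only [h], by simp only [h]⟩

theorem exists_isMatching (π π' : PMF T) : ∃ ω, IsMatching π π' ω := by
  refine ⟨π.bind fun s => π'.bind fun t => PMF.pure (s, t), ?_⟩
  have h := IsMatching.bind π fun s => IsMatching.bind π' fun t => isMatching_pure s t
  simpa only [PMF.bind_const, PMF.bind_pure] using h

theorem exists_isMatching_cost_le (d : T → T → ℝ≥0∞) (π π' : PMF T) {ε : ℝ≥0∞} (hε : ε ≠ 0) :
    ∃ ω, IsMatching π π' ω ∧ ∑' q : T × T, d q.1 q.2 * ω q ≤ kantorovich d π π' + ε := by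
  by_cases htop : kantorovich d π π' = ∞
  · obtain ⟨ω, hω⟩ := exists_isMatching π π'
    exact ⟨ω, hω, by simp [htop]⟩
  · obtain ⟨ω, hω, hcost⟩ : ∃ ω, ∃ _ : IsMatching π π' ω,
        ∑' q : T × T, d q.1 q.2 * ω q < kantorovich d π π' + ε := by
      simpa only [kantorovich, iInf_lt_iff] using ENNReal.lt_add_right htop hε
    exact ⟨ω, hω, hcost.le⟩

theorem kantorovich_pure_le (d : T → T → ℝ≥0∞) (s t : T) :
    kantorovich d (PMF.pure s) (PMF.pure t) ≤ d s t := by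
  classical
  refine (kantorovich_le_of_isMatching d (isMatching_pure s t)).trans_eq ?_
  have hoff (q : T × T) (hq : q ≠ (s, t)) : d q.1 q.2 * PMF.pure (s, t) q = 0 := by
    simp [PMF.pure_apply, hq]
  rw [tsum_eq_single (s, t) hoff]
  simp [PMF.pure_apply]

theorem kantorovich_bind_le (d : T → T → ℝ≥0∞) {I : Type v} (p : PMF I) (f g : I → PMF T) :
    kantorovich d (p.bind f) (p.bind g) ≤ ∑' i, p i * kantorovich d (f i) (g i) := by
  refine ENNReal.le_of_forall_pos_le_add fun ε hε _ => ?_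
  have hε' : (ε : ℝ≥0∞) ≠ 0 := ENNReal.coe_ne_zero.2 hε.ne'
  choose ω hω hcost using fun i => exists_isMatching_cost_le d (f i) (g i) hε'
  calc kantorovich d (p.bind f) (p.bind g)
      ≤ ∑' q : T × T, d q.1 q.2 * p.bind ω q :=
        kantorovich_le_of_isMatching d (IsMatching.bind p hω)
    _ = ∑' i, p i * ∑' q : T × T, d q.1 q.2 * ω i q := by
        simp only [PMF.bind_apply, ← ENNReal.tsum_mul_left]
        rw [ENNReal.tsum_comm]
        exact tsum_congr fun i => tsum_congr fun q => mul_left_comm _ _ _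
    _ ≤ ∑' i, p i * (kantorovich d (f i) (g i) + ε) := by gcongr with i; exact hcost i
    _ = ∑' i, p i * kantorovich d (f i) (g i) + ε := by
        simp only [mul_add, ENNReal.tsum_add, ENNReal.tsum_mul_right, PMF.tsum_coe, one_mul]

theorem kantorovich_self (hd : ∀ t, d t t = 0) (π : PMF T) : kantorovich d π π = 0 := by
  have hpure (t : T) : kantorovich d (PMF.pure t) (PMF.pure t) = 0 :=
    nonpos_iff_eq_zero.1 ((kantorovich_pure_le d t t).trans_eq (hd t))
  simpa [PMF.bind_pure, hpure] using kantorovich_bind_le d π PMF.pure PMF.pure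

theorem IsMatching.exists_glue {ω₁ ω₂ : PMF (T × T)} (h₁ : IsMatching π ρ ω₁)
    (h₂ : IsMatching ρ π' ω₂) : ∃ τ : T → T → T → ℝ≥0∞,
      (∀ x y, ∑' z, τ x y z = ω₁ (x, y)) ∧ (∀ y z, ∑' x, τ x y z = ω₂ (y, z)) := by
  -- Given the middle state, the outer two are drawn independently. Where `ρ y = 0`, the factor
  -- `(ρ y)⁻¹ = ∞` is multiplied by zero masses.
  refine ⟨fun x y z => ω₁ (x, y) * ω₂ (y, z) * (ρ y)⁻¹, fun x y => ?_, fun y z => ?_⟩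
  · simp only [ENNReal.tsum_mul_right, ENNReal.tsum_mul_left, h₂.1]
    by_cases hy : ρ y = 0
    · have hzero : ω₁ (x, y) = 0 := ENNReal.tsum_eq_zero.1 ((h₁.2 y).trans hy) x
      simp [hzero]
    · rw [mul_assoc, ENNReal.mul_inv_cancel hy (ρ.apply_ne_top y), mul_one]
  · simp only [ENNReal.tsum_mul_right, h₁.2]
    by_cases hy : ρ y = 0
    · have hzero : ω₂ (y, z) = 0 := ENNReal.tsum_eq_zero.1 ((h₂.1 y).trans hy) z
      simp [hzero]
    · rw [mul_right_comm, ENNReal.mul_inv_cancel hy (ρ.apply_ne_top y), one_mul]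

theorem kantorovich_triangle (hd : ∀ x y z, d x z ≤ d x y + d y z) (π ρ π' : PMF T) :
    kantorovich d π π' ≤ kantorovich d π ρ + kantorovich d ρ π' := by
  conv_rhs => simp only [kantorovich, ENNReal.iInf_add, ENNReal.add_iInf]
  refine le_iInf₂ fun ω₂ h₂ => le_iInf₂ fun ω₁ h₁ => ?_
  obtain ⟨τ, hτ₁, hτ₂⟩ := h₁.exists_glue h₂
  calc kantorovich d π π'
      ≤ ∑' x, ∑' z, d x z * ∑' y, τ x y z := by
        refine kantorovich_le_of_marginals d _ (fun x => ?_) fun z => ?_ <;> rw [ENNReal.tsum_comm]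
        · simp only [hτ₁, h₁.1]
        · simp only [hτ₂, h₂.2]
    _ ≤ ∑' x, ∑' z, ∑' y, (d x y * τ x y z + d y z * τ x y z) := by
        simp only [← ENNReal.tsum_mul_left, ← add_mul]
        gcongr
        exact hd _ _ _
    _ = ∑' x, ∑' y, ∑' z, d x y * τ x y z + ∑' y, ∑' z, ∑' x, d y z * τ x y z := by
        simp only [ENNReal.tsum_add]
        congr 1
        · exact tsum_congr fun x => ENNReal.tsum_comm
        · rw [ENNReal.tsum_comm, ENNReal.tsum_comm (f := fun y z => ∑' x, d y z * τ x y z)]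
          exact tsum_congr fun z => ENNReal.tsum_comm
    _ = ∑' q : T × T, d q.1 q.2 * ω₁ q + ∑' q : T × T, d q.1 q.2 * ω₂ q := by
        simp only [ENNReal.tsum_mul_left, hτ₁, hτ₂]
        rw [← ENNReal.tsum_prod (f := fun x y => d x y * ω₁ (x, y)),
          ← ENNReal.tsum_prod (f := fun x y => d x y * ω₂ (x, y))]

end Kantorovich

section Mix

variable {T : Type u}

/-- The mixture `μ ⊕_p ν` of two distributions, with weights `p` and `1 - p`. -/
noncomputable def mix (p : ℝ≥0∞) (hp : p ≤ 1) (μ ν : PMF T) : PMF T :=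
  (PMF.ofFintype ![p, 1 - p] (by simp [hp])).bind ![μ, ν]

theorem kantorovich_mix_le (d : T → T → ℝ≥0∞) {p : ℝ≥0∞} (hp : p ≤ 1) (μ ν μ' ν' : PMF T) :
    kantorovich d (mix p hp μ ν) (mix p hp μ' ν') ≤
      p * kantorovich d μ μ' + (1 - p) * kantorovich d ν ν' := by
  refine (kantorovich_bind_le d _ _ _).trans_eq ?_
  simp [tsum_fintype, PMF.ofFintype_apply]

theorem mul_kantorovich_mix_le_max (lam : ℝ≥0∞) (d : T → T → ℝ≥0∞) {p : ℝ≥0∞} (hp : p ≤ 1)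
    (μ ν μ' ν' : PMF T) :
    lam * kantorovich d (mix p hp μ ν) (mix p hp μ' ν') ≤
      max (lam * kantorovich d μ μ') (lam * kantorovich d ν ν') := by
  set m := max (kantorovich d μ μ') (kantorovich d ν ν')
  have hm : kantorovich d (mix p hp μ ν) (mix p hp μ' ν') ≤ m :=
    calc _ ≤ p * kantorovich d μ μ' + (1 - p) * kantorovich d ν ν' :=
          kantorovich_mix_le d hp μ ν μ' ν'
      _ ≤ p * m + (1 - p) * m := by gcongr <;> simp [m]
      _ = m := by rw [← add_mul, add_tsub_cancel_of_le hp, one_mul]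
  calc lam * kantorovich d (mix p hp μ ν) (mix p hp μ' ν') ≤ lam * m := by gcongr
    _ = _ := mul_max _ _ _

end Mix

section BisimFunctional

variable {T : Type u} {A : Type w} {tr : T → A → PMF T → Prop} {lam c : ℝ≥0∞}
  {d d' : T → T → ℝ≥0∞} {s t : T}

/-- The directed Hausdorff distance from the transitions of `s` to those of `t`: how well, in the
worst case, `t` can answer a transition of `s`. It is `∞` if `s` has a label that `t` lacks. -/
noncomputable def simDist (tr : T → A → PMF T → Prop) (lam : ℝ≥0∞) (d : T → T → ℝ≥0∞) (s t : T) :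
    ℝ≥0∞ :=
  ⨆ (a : A) (π : PMF T) (_ : tr s a π), ⨅ (π' : PMF T) (_ : tr t a π'), lam * kantorovich d π π'

theorem simDist_mono (h : d ≤ d') (s t : T) : simDist tr lam d s t ≤ simDist tr lam d' s t := by
  unfold simDist
  gcongr
  exact kantorovich_mono h _ _

theorem iInf_kantorovich_le_simDist {a : A} {π : PMF T} (h : tr s a π) :
    ⨅ (π' : PMF T) (_ : tr t a π'), lam * kantorovich d π π' ≤ simDist tr lam d s t :=
  le_iSup_of_le a (le_iSup₂_of_le π h le_rfl)

theorem simDist_le_iff : simDist tr lam d s t ≤ c ↔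
    ∀ a π, tr s a π → ∀ b, c < b → ∃ π', tr t a π' ∧ lam * kantorovich d π π' < b := by
  simp only [simDist, iSup_le_iff]
  refine forall₃_congr fun a π _ => ?_
  rw [← forall_gt_iff_le]
  simp only [iInf_lt_iff, exists_prop]

theorem simDist_le_of_forall_exists
    (h : ∀ a π, tr s a π → ∃ π', tr t a π' ∧ lam * kantorovich d π π' ≤ c) :
    simDist tr lam d s t ≤ c :=
  iSup_le fun a => iSup₂_le fun π hπ =>
    let ⟨π', hπ', hle⟩ := h a π hπ
    iInf₂_le_of_le π' hπ' hle

theorem exists_trans_of_simDist_ne_top (h : simDist tr lam d s t ≠ ∞) {a : A} {π : PMF T}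
    (hπ : tr s a π) : ∃ π', tr t a π' := by
  obtain ⟨π', hπ', -⟩ := simDist_le_iff.1 le_rfl a π hπ ∞ h.lt_top
  exact ⟨π', hπ'⟩

theorem exists_trans_of_simDist_le (ht : ∀ a, {π | tr t a π}.Finite) (hc : c ≠ ∞)
    (h : simDist tr lam d s t ≤ c) {a : A} {π : PMF T} (hπ : tr s a π) :
    ∃ π', tr t a π' ∧ lam * kantorovich d π π' ≤ c := by
  have hne : {π' | tr t a π'}.Nonempty :=
    exists_trans_of_simDist_ne_top (h.trans_lt hc.lt_top).ne hπ
  obtain ⟨π', hπ', hmin⟩ :=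
    Set.exists_min_image _ (fun π' => lam * kantorovich d π π') (ht a) hne
  exact ⟨π', hπ', (le_iInf₂ hmin).trans ((iInf_kantorovich_le_simDist hπ).trans h)⟩

theorem simDist_self (hd : ∀ t, d t t = 0) (t : T) : simDist tr lam d t t = 0 :=
  nonpos_iff_eq_zero.1 <| simDist_le_of_forall_exists fun _ π hπ =>
    ⟨π, hπ, by simp [kantorovich_self hd]⟩

theorem simDist_triangle (hd : ∀ x y z, d x z ≤ d x y + d y z) (s r t : T) :
    simDist tr lam d s t ≤ simDist tr lam d s r + simDist tr lam d r t := by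
  refine iSup_le fun a => iSup₂_le fun π hπ => ?_
  refine le_trans ?_ (add_le_add_left (iInf_kantorovich_le_simDist hπ) _)
  simp only [ENNReal.iInf_add]
  refine le_iInf₂ fun ρ hρ => ?_
  refine le_trans ?_ (add_le_add_right (iInf_kantorovich_le_simDist hρ) _)
  simp only [ENNReal.add_iInf]
  refine iInf₂_mono fun π' _ => ?_
  rw [← mul_add]
  gcongr
  exact kantorovich_triangle hd _ _ _

/-- The functional whose least fixed point is the `lam`-bisimilarity metric; its pre-fixed points
are the functions that satisfy the transfer condition in both directions. -/
noncomputable def bisimFunctional (tr : T → A → PMF T → Prop) (lam : ℝ≥0∞) :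
    (T → T → ℝ≥0∞) →o (T → T → ℝ≥0∞) where
  toFun d s t := min 1 (max (simDist tr lam d s t) (simDist tr lam d t s))
  monotone' _ _ h s t :=
    min_le_min le_rfl (max_le_max (simDist_mono h s t) (simDist_mono h t s))

theorem bisimFunctional_le_iff : bisimFunctional tr lam d s t ≤ c ↔
    1 ≤ c ∨ simDist tr lam d s t ≤ c ∧ simDist tr lam d t s ≤ c :=
  min_le_iff.trans (or_congr_right max_le_iff)

theorem isPseudometric_bisimFunctional (hd : IsPseudometric d) :
    IsPseudometric (bisimFunctional tr lam d) where
  le_one _ _ := min_le_left _ _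
  self t := nonpos_iff_eq_zero.1 <| bisimFunctional_le_iff.2 <| by simp [simDist_self hd.self]
  symm s t := congrArg (min 1) (max_comm _ _)
  triangle s t r := by
    have htri (x y z : T) :
        simDist tr lam d x z ≤ simDist tr lam d x y + simDist tr lam d y z :=
      simDist_triangle (fun x y z => hd.triangle x z y) x y z
    have hmax : max (simDist tr lam d s t) (simDist tr lam d t s) ≤
        max (simDist tr lam d s r) (simDist tr lam d r s) +
          max (simDist tr lam d r t) (simDist tr lam d t r) :=
      max_le ((htri s r t).trans (add_le_add (le_max_left _ _) (le_max_left _ _)))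
        ((htri t r s).trans ((add_comm _ _).trans_le
          (add_le_add (le_max_right _ _) (le_max_right _ _))))
    exact (min_le_min le_rfl hmax).trans ((min_add_distrib _ _ _).trans_le (min_le_right _ _))

theorem isPseudometric_sSup {S : Set (T → T → ℝ≥0∞)} (hS : ∀ d ∈ S, IsPseudometric d) :
    IsPseudometric (sSup S) := by
  have happ (s t : T) : sSup S s t = ⨆ d : S, d.1 s t := by rw [sSup_apply, iSup_apply]
  refine ⟨fun s t => ?_, fun t => ?_, fun s t => ?_, fun s t r => ?_⟩ <;> simp only [happ]
  · exact iSup_le fun d => (hS d d.2).le_one s t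
  · simp [(hS _ (Subtype.prop _)).self]
  · exact iSup_congr fun d => (hS d d.2).symm s t
  · exact iSup_le fun d => ((hS d d.2).triangle s t r).trans
      (add_le_add (le_iSup (fun d : S => d.1 s r) d) (le_iSup (fun d : S => d.1 r t) d))

theorem isPseudometric_lfp_bisimFunctional (tr : T → A → PMF T → Prop) (lam : ℝ≥0∞) :
    IsPseudometric (bisimFunctional tr lam).lfp :=
  OrderHom.lfp_induction _ (fun _ hd _ => isPseudometric_bisimFunctional hd)
    fun _ => isPseudometric_sSup

end BisimFunctional

section BisimMetric

variable {L : FirstOrder.Language.{u, v}} {A : Type w} {tr : TransRel L A} {lam : ℝ≥0∞}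
  {d : Proc L → Proc L → ℝ≥0∞}

theorem IsBisimMetric.bisimFunctional_le (h : IsBisimMetric tr lam d) :
    bisimFunctional tr lam d ≤ d := by
  intro s t
  refine bisimFunctional_le_iff.2 ((le_or_gt 1 (d s t)).imp_right fun hst => ⟨?_, ?_⟩)
  · exact simDist_le_of_forall_exists (h.transfer s t hst)
  · rw [h.pseudometric.symm s t] at hst ⊢
    exact simDist_le_of_forall_exists (h.transfer t s hst)

theorem IsPseudometric.isBisimMetric (hd : IsPseudometric d)
    (hfin : ∀ t a, {π | tr t a π}.Finite) (h : bisimFunctional tr lam d ≤ d) :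
    IsBisimMetric tr lam d where
  pseudometric := hd
  transfer t t' htt' _ _ hπ :=
    have hsim := ((bisimFunctional_le_iff.1 (h t t')).resolve_left htt'.not_ge).1
    exists_trans_of_simDist_le (hfin t') (htt'.trans ENNReal.one_lt_top).ne hsim hπ

theorem isLeast_isBisimMetric_lfp (hfin : ∀ t a, {π | tr t a π}.Finite) :
    IsLeast {d | IsBisimMetric tr lam d} (bisimFunctional tr lam).lfp :=
  ⟨(isPseudometric_lfp_bisimFunctional tr lam).isBisimMetric hfin
      (bisimFunctional tr lam).map_lfp.le,
    fun _ hd => OrderHom.lfp_le _ hd.bisimFunctional_le⟩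

end BisimMetric

section InducedModel

variable {L : FirstOrder.Language.{u, v}} {A : Type w}

/-- The distribution denoted by an open distribution term when its state variables stand for
processes and its distribution variables for distributions. -/
noncomputable def DTerm.eval {V W : Type} (σ : V → Proc L) (ρ : W → PMF (Proc L)) :
    DTerm L V W → PMF (Proc L)
  | .var m => ρ m
  | .dirac t => PMF.pure (t.subst σ)
  | .conv p _ θ => p.bind fun i => (θ i).eval σ ρ
  | .op f θ => (prodPMF fun i => (θ i).eval σ ρ).map fun ts => FirstOrder.Language.Term.func f ts

theorem DTerm.denote_subst {V W : Type} (σ : V → Proc L) (τ : W → CDTerm L) (θ : DTerm L V W) :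
    CDTerm.denote (θ.subst σ τ) = θ.eval σ fun m => CDTerm.denote (τ m) := by
  induction θ with
  | var m => rfl
  | dirac t => rfl
  | conv p hp θ ih => simp only [DTerm.subst, CDTerm.denote, DTerm.eval, ih]
  | op f θ ih => simp only [DTerm.subst, CDTerm.denote, DTerm.eval, ih]

/-- The variant of `Rule.Derives` in which distribution variables are instantiated by
distributions instead of closed distribution terms. -/
def Rule.Fires {n : ℕ} (r : Rule L A n) (tr : TransRel L A) (ts : Fin n → Proc L)
    (ρ : (Σ i, Fin (r.numPos i)) → PMF (Proc L)) (π : PMF (Proc L)) : Prop :=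
  (∀ i k, tr (ts i) (r.posAct i k) (ρ ⟨i, k⟩)) ∧
  (∀ i, ∀ b ∈ r.negAct i, ∀ π', ¬ tr (ts i) b π') ∧
  π = r.target.eval ts ρ

theorem Rule.derives_iff_fires {n : ℕ} (r : Rule L A n) (tr : TransRel L A) (ts : Fin n → Proc L)
    (σ : (Σ i, Fin (r.numPos i)) → CDTerm L) (π : PMF (Proc L)) :
    r.Derives tr ts σ π ↔ r.Fires tr ts (fun q => CDTerm.denote (σ q)) π := by
  rw [Rule.Derives, Rule.Fires, DTerm.denote_subst]

namespace PTSS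

variable (P : PTSS L A)

theorem isSupportedModel_trans : P.IsSupportedModel P.trans :=
  P.existsUnique_isSupportedModel.choose_spec.1

theorem exists_denote_of_trans {t : Proc L} {a : A} {π : PMF (Proc L)} (h : P.trans t a π) :
    ∃ θ : CDTerm L, CDTerm.denote θ = π := by
  obtain ⟨_, _, _, -, _, -, _, -, -, rfl⟩ := (P.isSupportedModel_trans t a π).1 h
  exact ⟨_, rfl⟩

theorem trans_func_iff {n : ℕ} (f : L.Functions n) (ts : Fin n → Proc L) (a : A)
    (π : PMF (Proc L)) :
    P.trans (.func f ts) a π ↔ ∃ r ∈ P.rules f a, ∃ ρ, r.Fires P.trans ts ρ π := by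
  rw [P.isSupportedModel_trans (.func f ts) a π]
  constructor
  · rintro ⟨_, _, _, hts, r, hr, σ, hσ⟩
    cases hts
    exact ⟨r, hr, _, (r.derives_iff_fires _ _ _ _).1 hσ⟩
  · rintro ⟨r, hr, ρ, hρ⟩
    choose σ hσ using fun q : Σ i, Fin (r.numPos i) => P.exists_denote_of_trans (hρ.1 q.1 q.2)
    obtain rfl : (fun q => CDTerm.denote (σ q)) = ρ := funext hσ
    exact ⟨n, f, ts, rfl, r, hr, σ, (r.derives_iff_fires _ _ _ _).2 hρ⟩

theorem finite_trans (t : Proc L) (a : A) : {π | P.trans t a π}.Finite := by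
  induction t generalizing a with
  | var e => exact e.elim
  | func f ts ih =>
    let premises (r : Rule L A _) : Set ((Σ i, Fin (r.numPos i)) → PMF (Proc L)) :=
      {ρ | ∀ q, P.trans (ts q.1) (r.posAct q.1 q.2) (ρ q)}
    have hpremises (r : Rule L A _) : (premises r).Finite :=
      Set.Finite.pi' fun q => ih q.1 (r.posAct q.1 q.2)
    refine ((P.finite_rules f a).biUnion fun r _ =>
      (hpremises r).image (r.target.eval ts)).subset fun π hπ => ?_
    obtain ⟨r, hr, ρ, hpos, -, hρ⟩ := (P.trans_func_iff f ts a π).1 hπ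
    exact Set.mem_biUnion hr ⟨ρ, fun q => hpos q.1 q.2, hρ.symm⟩

theorem bisimDist_eq_lfp (lam : ℝ≥0∞) : P.bisimDist lam = (bisimFunctional P.trans lam).lfp :=
  (isLeast_isBisimMetric_lfp P.finite_trans).isGLB.sInf_eq

theorem isLeast_bisimDist (lam : ℝ≥0∞) :
    IsLeast {d | IsBisimMetric P.trans lam d} (P.bisimDist lam) :=
  P.bisimDist_eq_lfp lam ▸ isLeast_isBisimMetric_lfp P.finite_trans

theorem bisimDist_symm (lam : ℝ≥0∞) (s t : Proc L) : P.bisimDist lam s t = P.bisimDist lam t s :=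
  (P.isLeast_bisimDist lam).1.pseudometric.symm s t

theorem bisimDist_le_iff {lam c : ℝ≥0∞} {s t : Proc L} :
    P.bisimDist lam s t ≤ c ↔ 1 ≤ c ∨
      simDist P.trans lam (P.bisimDist lam) s t ≤ c ∧
        simDist P.trans lam (P.bisimDist lam) t s ≤ c := by
  rw [← bisimFunctional_le_iff, P.bisimDist_eq_lfp, OrderHom.map_lfp]

theorem simDist_le_of_bisimDist_le {lam c : ℝ≥0∞} {s t : Proc L} (h : P.bisimDist lam s t ≤ c)
    (hc : c < 1) :
    simDist P.trans lam (P.bisimDist lam) s t ≤ c ∧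
      simDist P.trans lam (P.bisimDist lam) t s ≤ c :=
  (P.bisimDist_le_iff.1 h).resolve_left hc.not_ge

end PTSS

end InducedModel

section ProcessAlgebra

variable {A : Type u} {L : FirstOrder.Language.{v, w}} {φ : paLang A →ᴸ L} {tr : TransRel L A}

theorem exists_fires_ruleL_iff (a : A) (N : Finset A)
    (θ : {W : Type} → (μ δx δy : DTerm (paLang A) (Fin 2) W) → DTerm (paLang A) (Fin 2) W)
    (s t : Proc L) (π : PMF (Proc L)) :
    (∃ ρ, ((ruleL a N θ).map φ).Fires tr ![s, t] ρ π) ↔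
      ∃ μ, tr s a μ ∧ (∀ b ∈ N, ∀ π', ¬ tr t b π') ∧
        π = ((ruleL a N θ).map φ).target.eval ![s, t] fun _ => μ := by
  constructor
  · rintro ⟨ρ, hpos, hneg, rfl⟩
    refine ⟨ρ ⟨0, (0 : Fin 1)⟩, hpos 0 (0 : Fin 1), hneg 1, ?_⟩
    congr 1
    exact funext (Sigma.forall.2 (Fin.forall_fin_two.2
      ⟨Fin.forall_fin_one.2 rfl, fun k => Fin.elim0 k⟩))
  · rintro ⟨μ, hμ, hneg, hπ⟩
    refine ⟨fun _ => μ, ?_, ?_, hπ⟩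
    · exact Fin.forall_fin_two.2 ⟨fun _ => hμ, fun k => Fin.elim0 k⟩
    · exact Fin.forall_fin_two.2 ⟨fun b hb => (Finset.notMem_empty b hb).elim, hneg⟩

theorem exists_fires_ruleR_iff (a : A) (N : Finset A)
    (θ : {W : Type} → (ν δx δy : DTerm (paLang A) (Fin 2) W) → DTerm (paLang A) (Fin 2) W)
    (s t : Proc L) (π : PMF (Proc L)) :
    (∃ ρ, ((ruleR a N θ).map φ).Fires tr ![s, t] ρ π) ↔
      ∃ ν, tr t a ν ∧ (∀ b ∈ N, ∀ π', ¬ tr s b π') ∧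
        π = ((ruleR a N θ).map φ).target.eval ![s, t] fun _ => ν := by
  constructor
  · rintro ⟨ρ, hpos, hneg, rfl⟩
    refine ⟨ρ ⟨1, (0 : Fin 1)⟩, hpos 1 (0 : Fin 1), hneg 0, ?_⟩
    congr 1
    exact funext (Sigma.forall.2 (Fin.forall_fin_two.2
      ⟨fun k => Fin.elim0 k, Fin.forall_fin_one.2 rfl⟩))
  · rintro ⟨ν, hν, hneg, hπ⟩
    refine ⟨fun _ => ν, ?_, ?_, hπ⟩
    · exact Fin.forall_fin_two.2 ⟨fun k => Fin.elim0 k, fun _ => hν⟩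
    · exact Fin.forall_fin_two.2 ⟨hneg, fun b hb => (Finset.notMem_empty b hb).elim⟩

theorem exists_fires_ruleLR_iff (a b : A)
    (θ : {W : Type} → (μ ν δx δy : DTerm (paLang A) (Fin 2) W) → DTerm (paLang A) (Fin 2) W)
    (s t : Proc L) (π : PMF (Proc L)) :
    (∃ ρ, ((ruleLR a b θ).map φ).Fires tr ![s, t] ρ π) ↔
      ∃ μ ν, tr s a μ ∧ tr t b ν ∧
        π = ((ruleLR a b θ).map φ).target.eval ![s, t] fun q => ![μ, ν] q.1 := by
  constructor
  · rintro ⟨ρ, hpos, -, rfl⟩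
    refine ⟨ρ ⟨0, (0 : Fin 1)⟩, ρ ⟨1, (0 : Fin 1)⟩, hpos 0 (0 : Fin 1), hpos 1 (0 : Fin 1), ?_⟩
    congr 1
    exact funext (Sigma.forall.2 (Fin.forall_fin_two.2
      ⟨Fin.forall_fin_one.2 rfl, Fin.forall_fin_one.2 rfl⟩))
  · rintro ⟨μ, ν, hμ, hν, hπ⟩
    refine ⟨fun q => ![μ, ν] q.1, ?_, ?_, hπ⟩
    · exact Fin.forall_fin_two.2 ⟨fun _ => hμ, fun _ => hν⟩
    · exact fun _ c hc => (Finset.notMem_empty c hc).elim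

theorem DTerm.map_choice {V W : Type} {p : ℝ≥0∞} (h0 : 0 < p) (h1 : p < 1)
    (θ₁ θ₂ : DTerm (paLang A) V W) :
    (DTerm.choice p h0 h1 θ₁ θ₂).map φ = DTerm.choice p h0 h1 (θ₁.map φ) (θ₂.map φ) := by
  simp only [DTerm.choice, DTerm.map]
  congr 1
  exact funext (Fin.forall_fin_two.2 ⟨rfl, rfl⟩)

theorem DTerm.eval_choice {V W : Type} {p : ℝ≥0∞} (h0 : 0 < p) (h1 : p < 1)
    (θ₁ θ₂ : DTerm L V W) (σ : V → Proc L) (ρ : W → PMF (Proc L)) :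
    (DTerm.choice p h0 h1 θ₁ θ₂).eval σ ρ = mix p h1.le (θ₁.eval σ ρ) (θ₂.eval σ ρ) := by
  simp only [DTerm.choice, DTerm.eval, mix]
  congr 1
  exact funext (Fin.forall_fin_two.2 ⟨rfl, rfl⟩)

namespace IsDisjointExtension

variable {tick : A} {P : PTSS L A} {lam c : ℝ≥0∞} {d : Proc L → Proc L → ℝ≥0∞}
  {s₁ s₂ t₁ t₂ : Proc L}

theorem trans_func_iff (hP : IsDisjointExtension φ (paPTSS tick) P) {n : ℕ} (f : PAOp A n)
    (ts : Fin n → Proc L) (a : A) (π : PMF (Proc L)) :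
    P.trans (.func (φ.onFunction f) ts) a π ↔
      ∃ r ∈ paRules tick f a, ∃ ρ, (r.map φ).Fires P.trans ts ρ π := by
  rw [P.trans_func_iff, hP.rules_eq, Set.exists_mem_image]
  rfl

theorem trans_pre_iff (hP : IsDisjointExtension φ (paPTSS tick) P) {n : ℕ} (b : A)
    (p : PMF (Fin n)) (hp : ∀ i, 0 < p i) (ts : Fin n → Proc L) (a : A) (π : PMF (Proc L)) :
    P.trans (.func (φ.onFunction (PAOp.pre b p hp)) ts) a π ↔
      a = b ∧ π = p.bind fun i => PMF.pure (ts i) := by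
  rw [hP.trans_func_iff]
  constructor
  · rintro ⟨r, ⟨rfl, rfl⟩, ρ, -, -, hπ⟩
    exact ⟨rfl, hπ⟩
  · rintro ⟨rfl, rfl⟩
    exact ⟨_, ⟨rfl, rfl⟩, fun q => q.2.elim0, fun _ k => k.elim0,
      fun _ b hb => (Finset.notMem_empty b hb).elim, rfl⟩

theorem trans_alt_iff (hP : IsDisjointExtension φ (paPTSS tick) P) (s t : Proc L) (a : A)
    (π : PMF (Proc L)) :
    P.trans (.func (φ.onFunction PAOp.alt) ![s, t]) a π ↔ P.trans s a π ∨ P.trans t a π := by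
  rw [hP.trans_func_iff]
  simp only [paRules, Set.mem_union, Set.mem_singleton_iff, or_and_right, exists_or,
    exists_eq_left, exists_fires_ruleL_iff, exists_fires_ruleR_iff]
  simp [Rule.map, ruleL, ruleR, DTerm.map, DTerm.eval]

theorem trans_palt_iff (hP : IsDisjointExtension φ (paPTSS tick) P) {p : ℝ≥0∞} (h0 : 0 < p)
    (h1 : p < 1) (s t : Proc L) (a : A) (π : PMF (Proc L)) :
    P.trans (.func (φ.onFunction (PAOp.palt p h0 h1)) ![s, t]) a π ↔
      (P.trans s a π ∧ ∀ π', ¬ P.trans t a π') ∨ (P.trans t a π ∧ ∀ π', ¬ P.trans s a π') ∨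
        ∃ μ ν, P.trans s a μ ∧ P.trans t a ν ∧ π = mix p h1.le μ ν := by
  rw [hP.trans_func_iff]
  simp only [paRules, Set.mem_union, Set.mem_singleton_iff, or_and_right, exists_or,
    exists_eq_left, exists_fires_ruleL_iff, exists_fires_ruleR_iff, exists_fires_ruleLR_iff]
  simp [Rule.map, ruleL, ruleR, ruleLR, DTerm.map_choice, DTerm.eval_choice, DTerm.map, DTerm.eval,
    or_assoc]

theorem simDist_pre_le (hP : IsDisjointExtension φ (paPTSS tick) P) {n : ℕ} (a : A)
    (p : PMF (Fin n)) (hp : ∀ i, 0 < p i) (s t : Fin n → Proc L) :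
    simDist P.trans lam d (.func (φ.onFunction (PAOp.pre a p hp)) s)
        (.func (φ.onFunction (PAOp.pre a p hp)) t) ≤
      lam * ∑ i, p i * d (s i) (t i) := by
  refine simDist_le_of_forall_exists fun b π hπ => ?_
  obtain ⟨rfl, rfl⟩ := (hP.trans_pre_iff a p hp s b π).1 hπ
  refine ⟨_, (hP.trans_pre_iff b p hp t b _).2 ⟨rfl, rfl⟩, ?_⟩
  gcongr
  calc kantorovich d (p.bind fun i => PMF.pure (s i)) (p.bind fun i => PMF.pure (t i))
      ≤ ∑' i, p i * kantorovich d (PMF.pure (s i)) (PMF.pure (t i)) := kantorovich_bind_le _ _ _ _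
    _ = ∑ i, p i * kantorovich d (PMF.pure (s i)) (PMF.pure (t i)) := tsum_fintype _
    _ ≤ ∑ i, p i * d (s i) (t i) := by gcongr; exact kantorovich_pure_le _ _ _

theorem simDist_alt_le (hP : IsDisjointExtension φ (paPTSS tick) P)
    (h₁ : simDist P.trans lam d s₁ t₁ ≤ c) (h₂ : simDist P.trans lam d s₂ t₂ ≤ c) :
    simDist P.trans lam d (.func (φ.onFunction PAOp.alt) ![s₁, s₂])
      (.func (φ.onFunction PAOp.alt) ![t₁, t₂]) ≤ c := by
  rw [simDist_le_iff] at h₁ h₂ ⊢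
  intro a π hπ b hb
  simp only [hP.trans_alt_iff] at hπ ⊢
  rcases hπ with hπ | hπ
  · obtain ⟨π', hπ', hlt⟩ := h₁ a π hπ b hb
    exact ⟨π', .inl hπ', hlt⟩
  · obtain ⟨π', hπ', hlt⟩ := h₂ a π hπ b hb
    exact ⟨π', .inr hπ', hlt⟩

theorem simDist_palt_le (hP : IsDisjointExtension φ (paPTSS tick) P) {p : ℝ≥0∞} (h0 : 0 < p)
    (h1 : p < 1) (h₁ : simDist P.trans lam d s₁ t₁ ≤ c) (h₂ : simDist P.trans lam d s₂ t₂ ≤ c)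
    (h₁' : simDist P.trans lam d t₁ s₁ ≠ ∞) (h₂' : simDist P.trans lam d t₂ s₂ ≠ ∞) :
    simDist P.trans lam d (.func (φ.onFunction (PAOp.palt p h0 h1)) ![s₁, s₂])
      (.func (φ.onFunction (PAOp.palt p h0 h1)) ![t₁, t₂]) ≤ c := by
  -- The negative premises carry over to `tᵢ` because `sᵢ` has all labels of `tᵢ`: this is what the
  -- finiteness of the reverse distances expresses.
  rw [simDist_le_iff] at h₁ h₂ ⊢
  intro a π hπ b hb
  simp only [hP.trans_palt_iff] at hπ ⊢
  rcases hπ with ⟨hπ, hs₂⟩ | ⟨hπ, hs₁⟩ | ⟨μ, ν, hμ, hν, rfl⟩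
  · obtain ⟨π', hπ', hlt⟩ := h₁ a π hπ b hb
    have ht₂ (ρ) (hρ : P.trans t₂ a ρ) : False :=
      (exists_trans_of_simDist_ne_top h₂' hρ).elim hs₂
    exact ⟨π', .inl ⟨hπ', ht₂⟩, hlt⟩
  · obtain ⟨π', hπ', hlt⟩ := h₂ a π hπ b hb
    have ht₁ (ρ) (hρ : P.trans t₁ a ρ) : False :=
      (exists_trans_of_simDist_ne_top h₁' hρ).elim hs₁
    exact ⟨π', .inr (.inl ⟨hπ', ht₁⟩), hlt⟩
  · obtain ⟨μ', hμ', hμlt⟩ := h₁ a μ hμ b hb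
    obtain ⟨ν', hν', hνlt⟩ := h₂ a ν hν b hb
    exact ⟨mix p h1.le μ' ν', .inr (.inr ⟨μ', ν', hμ', hν', rfl⟩),
      (mul_kantorovich_mix_le_max lam d h1.le μ ν μ' ν').trans_lt (max_lt hμlt hνlt)⟩

theorem bisimDist_pre_le (hP : IsDisjointExtension φ (paPTSS tick) P) (lam : ℝ≥0∞) {n : ℕ} (a : A)
    (p : PMF (Fin n)) (hp : ∀ i, 0 < p i) (s t : Fin n → Proc L) :
    P.bisimDist lam (.func (φ.onFunction (PAOp.pre a p hp)) s)
        (.func (φ.onFunction (PAOp.pre a p hp)) t) ≤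
      lam * ∑ i, p i * P.bisimDist lam (s i) (t i) := by
  refine P.bisimDist_le_iff.2 (.inr ⟨hP.simDist_pre_le a p hp s t, ?_⟩)
  simp only [P.bisimDist_symm lam (s _)]
  exact hP.simDist_pre_le a p hp t s

theorem bisimDist_alt_le (hP : IsDisjointExtension φ (paPTSS tick) P) (lam : ℝ≥0∞)
    (s₁ s₂ t₁ t₂ : Proc L) :
    P.bisimDist lam (.func (φ.onFunction PAOp.alt) ![s₁, s₂])
        (.func (φ.onFunction PAOp.alt) ![t₁, t₂]) ≤
      max (P.bisimDist lam s₁ t₁) (P.bisimDist lam s₂ t₂) := by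
  refine P.bisimDist_le_iff.2 ((le_or_gt 1 _).imp_right fun hlt => ?_)
  obtain ⟨hst₁, hts₁⟩ := P.simDist_le_of_bisimDist_le (le_max_left _ _) hlt
  obtain ⟨hst₂, hts₂⟩ := P.simDist_le_of_bisimDist_le (le_max_right _ _) hlt
  exact ⟨hP.simDist_alt_le hst₁ hst₂, hP.simDist_alt_le hts₁ hts₂⟩

theorem bisimDist_palt_le (hP : IsDisjointExtension φ (paPTSS tick) P) (lam : ℝ≥0∞) {p : ℝ≥0∞}
    (h0 : 0 < p) (h1 : p < 1) (s₁ s₂ t₁ t₂ : Proc L) :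
    P.bisimDist lam (.func (φ.onFunction (PAOp.palt p h0 h1)) ![s₁, s₂])
        (.func (φ.onFunction (PAOp.palt p h0 h1)) ![t₁, t₂]) ≤
      max (P.bisimDist lam s₁ t₁) (P.bisimDist lam s₂ t₂) := by
  refine P.bisimDist_le_iff.2 ((le_or_gt 1 _).imp_right fun hlt => ?_)
  obtain ⟨hst₁, hts₁⟩ := P.simDist_le_of_bisimDist_le (le_max_left _ _) hlt
  obtain ⟨hst₂, hts₂⟩ := P.simDist_le_of_bisimDist_le (le_max_right _ _) hlt
  have hne {s t} (h : simDist P.trans lam (P.bisimDist lam) s t ≤ _) :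
      simDist P.trans lam (P.bisimDist lam) s t ≠ ∞ :=
    (h.trans_lt (hlt.trans ENNReal.one_lt_top)).ne
  exact ⟨hP.simDist_palt_le h0 h1 hst₁ hst₂ (hne hts₁) (hne hts₂),
    hP.simDist_palt_le h0 h1 hts₁ hts₂ (hne hst₁) (hne hst₂)⟩

end IsDisjointExtension

end ProcessAlgebra

end PPA

theorem mainTheorem3_general {A : Type*} (tick : A) {L : FirstOrder.Language}
    (φ : PPA.paLang A →ᴸ L) (P : PPA.PTSS L A)
    (hP : PPA.IsDisjointExtension φ (PPA.paPTSS tick) P)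
    (lam : ℝ≥0∞) :
    IsLeast {d | PPA.IsBisimMetric P.trans lam d} (P.bisimDist lam) ∧
    (∀ {n : ℕ} (a : A) (p : PMF (Fin n)) (hp : ∀ i, 0 < p i) (s t : Fin n → PPA.Proc L),
      P.bisimDist lam (.func (φ.onFunction (PPA.PAOp.pre a p hp)) s)
          (.func (φ.onFunction (PPA.PAOp.pre a p hp)) t) ≤
        lam * ∑ i, p i * P.bisimDist lam (s i) (t i)) ∧
    (∀ s₁ s₂ t₁ t₂ : PPA.Proc L,
      P.bisimDist lam (.func (φ.onFunction PPA.PAOp.alt) ![s₁, s₂])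
          (.func (φ.onFunction PPA.PAOp.alt) ![t₁, t₂]) ≤
        max (P.bisimDist lam s₁ t₁) (P.bisimDist lam s₂ t₂)) ∧
    (∀ (p : ℝ≥0∞) (h0 : 0 < p) (h1 : p < 1) (s₁ s₂ t₁ t₂ : PPA.Proc L),
      P.bisimDist lam (.func (φ.onFunction (PPA.PAOp.palt p h0 h1)) ![s₁, s₂])
          (.func (φ.onFunction (PPA.PAOp.palt p h0 h1)) ![t₁, t₂]) ≤
        max (P.bisimDist lam s₁ t₁) (P.bisimDist lam s₂ t₂)) :=
  ⟨P.isLeast_bisimDist lam, hP.bisimDist_pre_le lam, hP.bisimDist_alt_le lam,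
    fun _ => hP.bisimDist_palt_le lam⟩

theorem mainTheorem3 {A : Type*} (tick : A) {L : FirstOrder.Language}
    (φ : PPA.paLang A →ᴸ L) (P : PPA.PTSS L A)
    (hP : PPA.IsDisjointExtension φ (PPA.paPTSS tick) P)
    (lam : ℝ≥0∞) (hlam0 : 0 < lam) (hlam1 : lam ≤ 1) :
    IsLeast {d | PPA.IsBisimMetric P.trans lam d} (P.bisimDist lam) ∧
    (∀ {n : ℕ} (a : A) (p : PMF (Fin n)) (hp : ∀ i, 0 < p i) (s t : Fin n → PPA.Proc L),
      P.bisimDist lam (.func (φ.onFunction (PPA.PAOp.pre a p hp)) s)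
          (.func (φ.onFunction (PPA.PAOp.pre a p hp)) t) ≤
        lam * ∑ i, p i * P.bisimDist lam (s i) (t i)) ∧
    (∀ s₁ s₂ t₁ t₂ : PPA.Proc L,
      P.bisimDist lam (.func (φ.onFunction PPA.PAOp.alt) ![s₁, s₂])
          (.func (φ.onFunction PPA.PAOp.alt) ![t₁, t₂]) ≤
        max (P.bisimDist lam s₁ t₁) (P.bisimDist lam s₂ t₂)) ∧
    (∀ (p : ℝ≥0∞) (h0 : 0 < p) (h1 : p < 1) (s₁ s₂ t₁ t₂ : PPA.Proc L),
      P.bisimDist lam (.func (φ.onFunction (PPA.PAOp.palt p h0 h1)) ![s₁, s₂])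
          (.func (φ.onFunction (PPA.PAOp.palt p h0 h1)) ![t₁, t₂]) ≤
        max (P.bisimDist lam s₁ t₁) (P.bisimDist lam s₂ t₂)) :=
  mainTheorem3_general tick φ P hP lam
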